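/- Let $G$ and $H$ be two finite undirected graphs without loops and of the same order $n$, with adjacency matrices $A_G$ and $A_H$. Let $\mathsf{ML}(\cdot,\mathsf{tr},{}^*,\mathbb{1},\odot_v)$ be the set of well-formed expressions $e(X)$ that are built from one variable $X$, standing for a square complex matrix, by matrix multiplication $e_1\cdot e_2$, trace $\mathsf{tr}(e)$ (a $1\times 1$ matrix), conjugate transposition $e^*$, the one-vector $\mathbb{1}(e)$ (the all-ones column vector with as many rows as $e$), and the entrywise product $e_1\odot_v e_2$ of two column vectors of the same size. A sentence is such an expression whose value is a $1\times 1$ matrix for every square matrix $X$. The graphs $G$ and $H$ are called $\mathsf{ML}(\cdot,\mathsf{tr},{}^*,\mathbb{1},\odot_v)$-equivalent if $e(A_G)=e(A_H)$ for every sentence $e(X)$. They are co-spectral if $A_G$ and $A_H$ have the same eigenvalues with eigenspaces of the same dimensions. They have a common equitable partition if there are partitions $V_1,\dots,V_\ell$ and $W_1,\dots,W_\ell$ of the vertex sets of $G$ and $H$ such that, for all $i,j$, (a) any two vertices of $V_i$ have the same number of neighbours in $V_j$, and any two vertices of $W_i$ have the same number of neighbours in $W_j$; (b) $|V_i|=|W_i|$;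 and (c) each vertex of $V_i$ has in $G$ as many neighbours in $V_j$ as each vertex of $W_i$ has in $H$ in $W_j$. Then $G$ and $H$ are $\mathsf{ML}(\cdot,\mathsf{tr},{}^*,\mathbb{1},\odot_v)$-equivalent if and only if they are co-spectral and have a common equitable partition. -/

import Mathlib

namespace MatLang

/-- The two symbolic sizes that occur in the types of expressions over one square matrix
variable: `one` stands for the size `1` and `ord` for the number `n` of rows (and columns) of
the input matrix. -/
inductive Dim : Type
  | one : Dim
  | ord : Dim

/-- The value of a symbolic size when the input matrix is `n × n`. -/
abbrev Dim.size (n : ℕ) : Dim → ℕ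
  | Dim.one => 1
  | Dim.ord => n

/-- Well-formed expressions of the matrix query language `ML(·, tr, *, 𝟙, ⊙ᵥ)` over a single
square matrix variable `X`. An element of `Expr a b` is an expression of type `a × b`. -/
inductive Expr : Dim → Dim → Type
  /-- the matrix variable `X` -/
  | X : Expr Dim.ord Dim.ord
  /-- matrix multiplication `e₁ · e₂` -/
  | mul {a b c : Dim} (e₁ : Expr a b) (e₂ : Expr b c) : Expr a c
  /-- trace `tr(e)` -/
  | tr {a : Dim} (e : Expr a a) : Expr Dim.one Dim.one
  /-- conjugate transposition `e*` -/
  | ctr {a b : Dim} (e : Expr a b) : Expr b a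
  /-- one-vector `𝟙(e)`: the all-ones column vector with as many rows as `e` -/
  | ones {a b : Dim} (e : Expr a b) : Expr a Dim.one
  /-- pointwise multiplication `e₁ ⊙ᵥ e₂` of column vectors -/
  | vmul {a : Dim} (e₁ e₂ : Expr a Dim.one) : Expr a Dim.one

/-- The value `e(A)` of an expression on an `n × n` complex matrix `A`. -/
noncomputable def Expr.eval {n : ℕ} (A : Matrix (Fin n) (Fin n) ℂ) :
    {a b : Dim} → Expr a b → Matrix (Fin (a.size n)) (Fin (b.size n)) ℂ
  | _, _, Expr.X => A
  | _, _, Expr.mul e₁ e₂ => e₁.eval A * e₂.eval A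
  | _, _, Expr.tr e => Matrix.of fun _ _ => (e.eval A).trace
  | _, _, Expr.ctr e => (e.eval A).conjTranspose
  | _, _, Expr.ones _ => Matrix.of fun _ _ => 1
  | _, _, Expr.vmul e₁ e₂ => Matrix.of fun i j => e₁.eval A i j * e₂.eval A i j

/-- A sentence is an expression that always returns a `1 × 1` matrix. -/
abbrev Sentence : Type := Expr Dim.one Dim.one

/-- Equivalence of matrices: no sentence distinguishes them. -/
def MatrixEquiv {n : ℕ} (A B : Matrix (Fin n) (Fin n) ℂ) : Prop :=
  ∀ e : Sentence, e.eval A = e.eval B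

/-- Equivalence of graphs of the same order: their adjacency matrices are equivalent. -/
def GraphEquiv {n : ℕ} (G H : SimpleGraph (Fin n)) [DecidableRel G.Adj] [DecidableRel H.Adj] :
    Prop :=
  MatrixEquiv (G.adjMatrix ℂ) (H.adjMatrix ℂ)

/-- The spectrum of a graph: the set of all pairs `(μ, m)` of an eigenvalue `μ` of the adjacency
matrix and the dimension `m` of its eigenspace. -/
noncomputable def spec {n : ℕ} (G : SimpleGraph (Fin n)) [DecidableRel G.Adj] : Set (ℂ × ℕ) :=
  {p | Module.End.HasEigenvalue (G.adjMatrix ℂ).mulVecLin p.1 ∧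
    p.2 = Module.finrank ℂ (Module.End.eigenspace (G.adjMatrix ℂ).mulVecLin p.1)}

/-- Two graphs are co-spectral if they have the same spectrum. -/
def CoSpectral {n : ℕ} (G H : SimpleGraph (Fin n)) [DecidableRel G.Adj] [DecidableRel H.Adj] :
    Prop :=
  spec G = spec H

/-- The number of vertices in `S` that are adjacent to `v`. -/
def degIn {n : ℕ} (G : SimpleGraph (Fin n)) [DecidableRel G.Adj] (v : Fin n)
    (S : Finset (Fin n)) : ℕ :=
  (S.filter fun w => G.Adj v w).card

/-- The indexed family `P` is a partition of the vertex set into nonempty, pairwise disjoint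
parts. -/
def IsPartition {n l : ℕ} (P : Fin l → Finset (Fin n)) : Prop :=
  (∀ i, (P i).Nonempty) ∧ ∀ v, ∃! i, v ∈ P i

/-- The partition `P` is equitable for `G`: any two vertices in the same part have the same number
of neighbours in each part. -/
def IsEquitable {n l : ℕ} (G : SimpleGraph (Fin n)) [DecidableRel G.Adj]
    (P : Fin l → Finset (Fin n)) : Prop :=
  IsPartition P ∧ ∀ i j, ∀ v ∈ P i, ∀ v' ∈ P i, degIn G v (P j) = degIn G v' (P j)

/-- `G` and `H` have a common equitable partition. -/
def HaveCommonEquitablePartition {n : ℕ} (G H : SimpleGraph (Fin n)) [DecidableRel G.Adj]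
    [DecidableRel H.Adj] : Prop :=
  ∃ (l : ℕ) (P Q : Fin l → Finset (Fin n)), IsEquitable G P ∧ IsEquitable H Q ∧
    (∀ i, (P i).card = (Q i).card) ∧
    ∀ i j, ∀ v ∈ P i, ∀ w ∈ Q i, degIn G v (P j) = degIn H w (Q j)

end MatLang

namespace MatLang

open Finset Matrix

/-! ### Spectra of graphs and traces of powers -/

section Hermitian

variable {ι : Type*} [Fintype ι] [DecidableEq ι] {A : Matrix ι ι ℂ}

/-! Co-spectrality of Hermitian matrices amounts to equality of the traces of all powers
(`coSpectral_iff_trace_pow`). Given a common equitable partition, every expression evaluates on the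
two graphs either to the same power of the two adjacency matrices, or to rank-one matrices of
vectors that are constant on parts with the same constants (`powRel_or_rankOneRel_eval`). Sentences
are of the second kind, with scalar factors, hence agree. Conversely, the sentences `tr(X ⋯ X)` give
the traces. Two vertices, of either graph, get the same colour if no vector expression separates
them. Products `⊙ᵥ` make the span of the vector expressions an algebra, so by interpolation it
contains the indicator of each colour. Sums over the vertices agree on this span, which matches the
sizes of the colour classes. Multiplication by `X` preserves it, so the neighbour counts into a
colour depend only on the colour. -/

theorem trace_pow_eq_sum_eigenvalues (hA : A.IsHermitian) (k : ℕ) :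
    (A ^ k).trace = ∑ i, (hA.eigenvalues i : ℂ) ^ k := by
  conv_lhs => rw [hA.spectral_theorem, ← map_pow, Unitary.conjStarAlgAut_apply, trace_mul_comm,
    ← mul_assoc, Unitary.coe_star_mul_self, one_mul, diagonal_pow, trace_diagonal]
  simp

/-- Rank-nullity for `A - μ`, which is unitarily similar to a diagonal matrix whose rank is the
number of its nonzero entries. -/
theorem finrank_eigenspace_eq_card (hA : A.IsHermitian) (μ : ℂ) :
    Module.finrank ℂ (Module.End.eigenspace A.mulVecLin μ) =
      #{i | (hA.eigenvalues i : ℂ) = μ} := by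
  have hsub : A - scalar ι μ = (hA.eigenvectorUnitary : Matrix ι ι ℂ) *
      diagonal (fun i => (hA.eigenvalues i : ℂ) - μ) *
      (star hA.eigenvectorUnitary : Matrix ι ι ℂ) := by
    have hd : diagonal (fun i => (hA.eigenvalues i : ℂ) - μ) =
        diagonal (RCLike.ofReal ∘ hA.eigenvalues) - scalar ι μ := by
      ext i j
      by_cases h : i = j <;> simp [h]
    rw [hd, mul_sub, sub_mul]
    conv_lhs => rw [hA.spectral_theorem, Unitary.conjStarAlgAut_apply]
    congr 1
    rw [← (scalar_commute μ (fun _ => mul_comm _ _) _).eq, mul_assoc,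
      Unitary.mul_star_self_of_mem hA.eigenvectorUnitary.2, mul_one]
  have hrank : (A - scalar ι μ).rank = #{i | ¬ (hA.eigenvalues i : ℂ) = μ} := by
    rw [hsub, ← Unitary.coe_star, rank_mul_eq_left_of_isUnit_det, rank_mul_eq_right_of_isUnit_det,
      rank_diagonal, Fintype.card_subtype]
    · simp only [ne_eq, sub_eq_zero]
    · exact (isUnit_iff_isUnit_det _).1 (Unitary.toUnits hA.eigenvectorUnitary).isUnit
    · exact (isUnit_iff_isUnit_det _).1 (Unitary.toUnits (star hA.eigenvectorUnitary)).isUnit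
  have hker : Module.End.eigenspace A.mulVecLin μ = LinearMap.ker (A - scalar ι μ).mulVecLin := by
    ext x
    rw [Module.End.mem_eigenspace_iff, LinearMap.mem_ker, mulVecLin_apply, mulVecLin_apply,
      sub_mulVec, sub_eq_zero, scalar_apply, ← smul_one_eq_diagonal, smul_mulVec, one_mulVec]
  have hsum := (A - scalar ι μ).mulVecLin.finrank_range_add_finrank_ker
  rw [← hker, ← Matrix.rank, hrank, Module.finrank_fintype_fun_eq_card] at hsum
  have hcard := card_filter_add_card_filter_not (s := (univ : Finset ι))
    (fun i => (hA.eigenvalues i : ℂ) = μ)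
  rw [card_univ] at hcard
  omega

end Hermitian

/-- Being an eigenvalue means that this dimension is nonzero, so `spec` is the graph of the
dimension function restricted to its support. -/
theorem coSpectral_iff_finrank {n : ℕ} (G H : SimpleGraph (Fin n)) [DecidableRel G.Adj]
    [DecidableRel H.Adj] :
    CoSpectral G H ↔ ∀ μ : ℂ,
      Module.finrank ℂ (Module.End.eigenspace (G.adjMatrix ℂ).mulVecLin μ) =
        Module.finrank ℂ (Module.End.eigenspace (H.adjMatrix ℂ).mulVecLin μ) := by
  have key (f : Module.End ℂ (Fin n → ℂ)) (μ : ℂ) :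
      f.HasEigenvalue μ ↔ Module.finrank ℂ (f.eigenspace μ) ≠ 0 := by
    rw [Module.End.hasEigenvalue_iff, ne_eq, ne_eq, Submodule.finrank_eq_zero]
  simp only [CoSpectral, spec, key, Set.ext_iff, Set.mem_ofPred_eq, Prod.forall]
  constructor
  · intro h μ
    by_contra hne
    have h₁ := h μ (Module.finrank ℂ (Module.End.eigenspace (G.adjMatrix ℂ).mulVecLin μ))
    have h₂ := h μ (Module.finrank ℂ (Module.End.eigenspace (H.adjMatrix ℂ).mulVecLin μ))
    simp only [and_true, hne, and_false, iff_false, not_not, Ne.symm hne, false_iff] at h₁ h₂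
    exact hne (h₁.trans h₂.symm)
  · intro h μ m
    rw [h]

theorem sum_comp_eq_sum_card {ι : Type*} [Fintype ι] (f : ι → ℂ) (g : ℂ → ℂ) (s : Finset ℂ)
    (hs : ∀ i, f i ∈ s) : ∑ i, g (f i) = ∑ μ ∈ s, (#{i | f i = μ} : ℂ) * g μ := by
  rw [← sum_fiberwise_of_maps_to (s := univ) (t := s) (g := f) (fun i _ => hs i)]
  refine sum_congr rfl fun μ _ => ?_
  rw [← nsmul_eq_mul, ← sum_const]
  exact sum_congr rfl fun i hi => by rw [(mem_filter.1 hi).2]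

/-! ### Algebras of functions on a finite set -/

-- Lagrange interpolation: if `f ∈ S` separates `y` from `x`, then `(f - f y) / (f x - f y)` is `1`
-- on the class of `x` and `0` at `y`. The product of these factors over all `y` is the indicator.
open Classical in
theorem indicator_mem_adjoin {κ : Type*} [Finite κ] (S : Set (κ → ℂ)) (x : κ) :
    (fun y => if ∀ f ∈ S, f y = f x then (1 : ℂ) else 0) ∈ Algebra.adjoin ℂ S := by
  have := Fintype.ofFinite κ
  have hsep (y : κ) : ∃ g ∈ Algebra.adjoin ℂ S, (∀ z, (∀ f ∈ S, f z = f x) → g z = 1) ∧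
      ((¬ ∀ f ∈ S, f y = f x) → g y = 0) := by
    by_cases hy : ∀ f ∈ S, f y = f x
    · exact ⟨1, one_mem _, fun _ _ => rfl, fun h => absurd hy h⟩
    · push Not at hy
      obtain ⟨f, hf, hne⟩ := hy
      refine ⟨(f x - f y)⁻¹ • (f - algebraMap ℂ _ (f y)), Subalgebra.smul_mem _
        (sub_mem (Algebra.subset_adjoin hf) (Subalgebra.algebraMap_mem _ _)) _, fun z hz => ?_,
        fun _ => ?_⟩
      · simp [hz f hf, inv_mul_cancel₀ (sub_ne_zero.2 (Ne.symm hne))]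
      · simp
  choose g hg hg₁ hg₀ using hsep
  convert prod_mem (S := Algebra.adjoin ℂ S) (t := univ) (f := g) (fun y _ => hg y) using 1
  ext z
  rw [prod_apply]
  split_ifs with hz
  · exact (prod_eq_one fun y _ => hg₁ y z hz).symm
  · exact (prod_eq_zero (f := fun y => g y z) (mem_univ z) (hg₀ z hz)).symm

/-- On the disjoint union of the index sets, the difference of the two sums kills all powers of one
function `F`, hence the algebra generated by `F`, which contains the indicators of its level sets.
-/
theorem card_fiber_eq_of_sum_pow_eq {ι κ : Type*} [Fintype ι] [Fintype κ] (f : ι → ℂ) (g : κ → ℂ)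
    (h : ∀ k : ℕ, ∑ i, f i ^ k = ∑ j, g j ^ k) (μ : ℂ) : #{i | f i = μ} = #{j | g j = μ} := by
  classical
  let F : ι ⊕ κ → ℂ := Sum.elim f g
  let D : (ι ⊕ κ → ℂ) →ₗ[ℂ] ℂ :=
    ∑ i, LinearMap.proj (Sum.inl i) - ∑ j, LinearMap.proj (Sum.inr j)
  have hD : ∀ φ ∈ Algebra.adjoin ℂ {F}, D φ = 0 := by
    intro φ hφ
    rw [← Subalgebra.mem_toSubmodule, Algebra.adjoin_eq_span, ← Submonoid.powers_eq_closure] at hφ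
    refine (Submodule.span_le (p := LinearMap.ker D)).2 ?_ hφ
    rintro _ ⟨k, rfl⟩
    simp [D, F, h]
  have key (x : ι ⊕ κ) : #{i | f i = F x} = #{j | g j = F x} := by
    have := hD _ (indicator_mem_adjoin {F} x)
    rw [← Nat.cast_inj (R := ℂ), natCast_card_filter, natCast_card_filter]
    convert sub_eq_zero.1 (show _ - _ = (0 : ℂ) by simpa [D, F] using this) <;> rfl
  by_cases hμ : ∃ x, F x = μ
  · obtain ⟨x, rfl⟩ := hμ
    exact key x
  · push Not at hμ
    have hf (i : ι) : f i ≠ μ := hμ (Sum.inl i)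
    have hg (j : κ) : g j ≠ μ := hμ (Sum.inr j)
    simp [hf, hg]

theorem coSpectral_iff_trace_pow {n : ℕ} (G H : SimpleGraph (Fin n)) [DecidableRel G.Adj]
    [DecidableRel H.Adj] :
    CoSpectral G H ↔ ∀ k : ℕ, (G.adjMatrix ℂ ^ k).trace = (H.adjMatrix ℂ ^ k).trace := by
  have hG : (G.adjMatrix ℂ).IsHermitian := G.isHermitian_adjMatrix ℂ
  have hH : (H.adjMatrix ℂ).IsHermitian := H.isHermitian_adjMatrix ℂ
  simp only [coSpectral_iff_finrank, finrank_eigenspace_eq_card hG, finrank_eigenspace_eq_card hH,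
    trace_pow_eq_sum_eigenvalues hG, trace_pow_eq_sum_eigenvalues hH]
  refine ⟨fun h k => ?_, fun h => card_fiber_eq_of_sum_pow_eq _ _ h⟩
  classical
  -- Both sums are grouped over the union of the two spectra, so that they can be compared term by
  -- term.
  have hs := fun f : Fin n → ℂ => sum_comp_eq_sum_card f (· ^ k)
    (univ.image (fun i => (hG.eigenvalues i : ℂ)) ∪ univ.image fun i => (hH.eigenvalues i : ℂ))
  rw [hs (fun i => (hG.eigenvalues i : ℂ)) (by simp), hs (fun i => (hH.eigenvalues i : ℂ)) (by simp)]
  exact sum_congr rfl fun μ _ => by rw [h]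

/-! ### Invariance of sentences under a common equitable partition -/

section Invariance

variable {n l : ℕ} {G H : SimpleGraph (Fin n)} [DecidableRel G.Adj] [DecidableRel H.Adj]
  {P Q : Fin l → Finset (Fin n)}

theorem IsPartition.sum_eq {R : Type*} [AddCommMonoid R] (hP : IsPartition P) (f : Fin n → R) :
    ∑ v, f v = ∑ j, ∑ v ∈ P j, f v := by
  rw [← sum_biUnion fun i _ j _ hij => disjoint_left.2 fun v hi hj =>
    hij ((hP.2 v).unique hi hj)]
  refine sum_congr (Eq.symm ?_) fun _ _ => rfl
  exact eq_univ_iff_forall.2 fun v =>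
    mem_biUnion.2 ⟨_, mem_univ _, (hP.2 v).exists.choose_spec⟩

/-- Two vectors correspond to each other along two partitions: they are constant on the parts, with
the same constants. Scalars correspond if they are equal. -/
def VecRel (P Q : Fin l → Finset (Fin n)) :
    (a : Dim) → (Fin (a.size n) → ℂ) → (Fin (a.size n) → ℂ) → Prop
  | Dim.one, u, u' => u = u'
  | Dim.ord, u, u' => ∃ c : Fin l → ℂ, ∀ i, (∀ v ∈ P i, u v = c i) ∧ ∀ w ∈ Q i, u' w = c i

theorem VecRel.const (z : ℂ) : ∀ {a : Dim}, VecRel P Q a (fun _ => z) fun _ => z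
  | Dim.one => rfl
  | Dim.ord => ⟨fun _ => z, fun _ => ⟨fun _ _ => rfl, fun _ _ => rfl⟩⟩

theorem VecRel.mul : ∀ {a : Dim} {u u' v v' : Fin (a.size n) → ℂ}, VecRel P Q a u u' →
    VecRel P Q a v v' → VecRel P Q a (u * v) (u' * v')
  | Dim.one, _, _, _, _, h₁, h₂ => by
    obtain rfl : _ = _ := h₁
    obtain rfl : _ = _ := h₂
    rfl
  | Dim.ord, _, _, _, _, ⟨c, hc⟩, ⟨d, hd⟩ => ⟨c * d, fun i =>
      ⟨fun v hv => congrArg₂ (· * ·) ((hc i).1 v hv) ((hd i).1 v hv),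
        fun w hw => congrArg₂ (· * ·) ((hc i).2 w hw) ((hd i).2 w hw)⟩⟩

theorem VecRel.smul {a : Dim} {u u' : Fin (a.size n) → ℂ} (z : ℂ) (h : VecRel P Q a u u') :
    VecRel P Q a (z • u) (z • u') :=
  (VecRel.const z).mul h

theorem VecRel.star : ∀ {a : Dim} {u u' : Fin (a.size n) → ℂ}, VecRel P Q a u u' →
    VecRel P Q a (star u) (star u')
  | Dim.one, _, _, h => congrArg Star.star h
  | Dim.ord, _, _, ⟨c, hc⟩ => ⟨Star.star c, fun i =>
      ⟨fun v hv => congrArg Star.star ((hc i).1 v hv),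
        fun w hw => congrArg Star.star ((hc i).2 w hw)⟩⟩

theorem VecRel.sum_eq (hP : IsPartition P) (hQ : IsPartition Q)
    (hcard : ∀ i, (P i).card = (Q i).card) :
    ∀ {a : Dim} {u u' : Fin (a.size n) → ℂ}, VecRel P Q a u u' → ∑ i, u i = ∑ i, u' i
  | Dim.one, _, _, h => by
    obtain rfl : _ = _ := h
    rfl
  | Dim.ord, u, u', ⟨c, hc⟩ => by
    change ∑ i : Fin n, u i = ∑ i : Fin n, u' i
    rw [hP.sum_eq, hQ.sum_eq]
    refine sum_congr rfl fun j _ => ?_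
    rw [sum_congr rfl (hc j).1, sum_congr rfl (hc j).2, sum_const, sum_const, hcard]

theorem adjMatrix_mulVec_eq_sum_degIn (hP : IsPartition P) (u : Fin n → ℂ) (c : Fin l → ℂ)
    (hc : ∀ i, ∀ v ∈ P i, u v = c i) (v : Fin n) :
    (G.adjMatrix ℂ *ᵥ u) v = ∑ j, (degIn G v (P j) : ℂ) * c j := by
  rw [mulVec, dotProduct, hP.sum_eq]
  refine sum_congr rfl fun j _ => ?_
  simp only [SimpleGraph.adjMatrix_apply, ite_mul, one_mul, zero_mul]
  rw [← sum_filter, degIn, ← nsmul_eq_mul, ← sum_const]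
  exact sum_congr rfl fun w hw => hc j w (mem_filter.1 hw).1

theorem VecRel.adjMatrix_mulVec (hP : IsEquitable G P) (hQ : IsEquitable H Q)
    (hdeg : ∀ i j, ∀ v ∈ P i, ∀ w ∈ Q i, degIn G v (P j) = degIn H w (Q j))
    {u u' : Fin n → ℂ} (h : VecRel P Q Dim.ord u u') :
    VecRel P Q Dim.ord (G.adjMatrix ℂ *ᵥ u) (H.adjMatrix ℂ *ᵥ u') := by
  obtain ⟨c, hc⟩ := h
  -- The constant on part `i` is read off at a representative in `P i`, for both graphs.
  refine ⟨fun i => ∑ j, (degIn G (hP.1.1 i).choose (P j) : ℂ) * c j, fun i =>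
    ⟨fun v hv => ?_, fun w hw => ?_⟩⟩
  · rw [adjMatrix_mulVec_eq_sum_degIn hP.1 u c fun i => (hc i).1]
    exact sum_congr rfl fun j _ => by rw [hP.2 i j v hv _ (hP.1.1 i).choose_spec]
  · rw [adjMatrix_mulVec_eq_sum_degIn hQ.1 u' c fun i => (hc i).2]
    exact sum_congr rfl fun j _ => by rw [hdeg i j _ (hP.1.1 i).choose_spec w hw]

theorem VecRel.adjMatrix_pow_mulVec (hP : IsEquitable G P) (hQ : IsEquitable H Q)
    (hdeg : ∀ i j, ∀ v ∈ P i, ∀ w ∈ Q i, degIn G v (P j) = degIn H w (Q j))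
    {u u' : Fin n → ℂ} (h : VecRel P Q Dim.ord u u') (k : ℕ) :
    VecRel P Q Dim.ord ((G.adjMatrix ℂ ^ k) *ᵥ u) ((H.adjMatrix ℂ ^ k) *ᵥ u') := by
  induction k with
  | zero => simpa using h
  | succ k ih =>
    rw [pow_succ', pow_succ', ← mulVec_mulVec, ← mulVec_mulVec]
    exact ih.adjMatrix_mulVec hP hQ hdeg

/-- Two square matrices are the same power of `A` and of `B`. -/
def PowRel (A B : Matrix (Fin n) (Fin n) ℂ) : (a b : Dim) →
    Matrix (Fin (a.size n)) (Fin (b.size n)) ℂ → Matrix (Fin (a.size n)) (Fin (b.size n)) ℂ → Prop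
  | Dim.ord, Dim.ord, M, N => ∃ k : ℕ, M = A ^ k ∧ N = B ^ k
  | _, _, _, _ => False

/-- Two matrices are rank-one matrices of corresponding vectors. -/
def RankOneRel (P Q : Fin l → Finset (Fin n)) (a b : Dim)
    (M N : Matrix (Fin (a.size n)) (Fin (b.size n)) ℂ) : Prop :=
  ∃ u u' v v', VecRel P Q a u u' ∧ VecRel P Q b v v' ∧ M = vecMulVec u v ∧ N = vecMulVec u' v'

theorem RankOneRel.mul (hP : IsPartition P) (hQ : IsPartition Q)
    (hcard : ∀ i, (P i).card = (Q i).card) {a b c : Dim}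
    {M N : Matrix (Fin (a.size n)) (Fin (b.size n)) ℂ}
    {M' N' : Matrix (Fin (b.size n)) (Fin (c.size n)) ℂ}
    (h₁ : RankOneRel P Q a b M N) (h₂ : RankOneRel P Q b c M' N') :
    RankOneRel P Q a c (M * M') (N * N') := by
  obtain ⟨u, u', v, v', hu, hv, rfl, rfl⟩ := h₁
  obtain ⟨x, x', y, y', hx, hy, rfl, rfl⟩ := h₂
  have hdot : v ⬝ᵥ x = v' ⬝ᵥ x' := (hv.mul hx).sum_eq hP hQ hcard
  refine ⟨_, _, _, _, hu, hy.smul (v ⬝ᵥ x), vecMulVec_mul_vecMulVec .., ?_⟩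
  rw [hdot, vecMulVec_mul_vecMulVec]

theorem RankOneRel.conjTranspose {a b : Dim} {M N : Matrix (Fin (a.size n)) (Fin (b.size n)) ℂ}
    (h : RankOneRel P Q a b M N) : RankOneRel P Q b a Mᴴ Nᴴ := by
  obtain ⟨u, u', v, v', hu, hv, rfl, rfl⟩ := h
  exact ⟨_, _, _, _, hv.star, hu.star, conjTranspose_vecMulVec .., conjTranspose_vecMulVec ..⟩

theorem RankOneRel.pow_mul (hP : IsEquitable G P) (hQ : IsEquitable H Q)
    (hdeg : ∀ i j, ∀ v ∈ P i, ∀ w ∈ Q i, degIn G v (P j) = degIn H w (Q j)) {b : Dim}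
    {M N : Matrix (Fin n) (Fin (b.size n)) ℂ} (h : RankOneRel P Q Dim.ord b M N) (k : ℕ) :
    RankOneRel P Q Dim.ord b (G.adjMatrix ℂ ^ k * M) (H.adjMatrix ℂ ^ k * N) := by
  obtain ⟨u, u', v, v', hu, hv, rfl, rfl⟩ := h
  exact ⟨_, _, _, _, hu.adjMatrix_pow_mulVec hP hQ hdeg k, hv, mul_vecMulVec .., mul_vecMulVec ..⟩

theorem conjTranspose_adjMatrix_pow (G : SimpleGraph (Fin n)) [DecidableRel G.Adj] (k : ℕ) :
    (G.adjMatrix ℂ ^ k)ᴴ = G.adjMatrix ℂ ^ k := by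
  rw [conjTranspose_pow, (G.isHermitian_adjMatrix ℂ).eq]

theorem RankOneRel.mul_pow (hP : IsEquitable G P) (hQ : IsEquitable H Q)
    (hdeg : ∀ i j, ∀ v ∈ P i, ∀ w ∈ Q i, degIn G v (P j) = degIn H w (Q j)) {b : Dim}
    {M N : Matrix (Fin (b.size n)) (Fin n) ℂ} (h : RankOneRel P Q b Dim.ord M N) (k : ℕ) :
    RankOneRel P Q b Dim.ord (M * G.adjMatrix ℂ ^ k) (N * H.adjMatrix ℂ ^ k) := by
  simpa only [conjTranspose_mul, conjTranspose_conjTranspose, conjTranspose_adjMatrix_pow] using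
    (h.conjTranspose.pow_mul hP hQ hdeg k).conjTranspose

/-- Powers occur only in type `ord × ord`; any factor through `𝟙`, `tr` or `⊙ᵥ` produces rank one,
which absorbs powers on either side. The hypothesis `htr` serves only for the trace of a power; the
trace of a rank-one matrix is a sum that `VecRel.sum_eq` handles. -/
theorem powRel_or_rankOneRel_eval (hP : IsEquitable G P) (hQ : IsEquitable H Q)
    (hcard : ∀ i, (P i).card = (Q i).card)
    (hdeg : ∀ i j, ∀ v ∈ P i, ∀ w ∈ Q i, degIn G v (P j) = degIn H w (Q j))
    (htr : ∀ k : ℕ, (G.adjMatrix ℂ ^ k).trace = (H.adjMatrix ℂ ^ k).trace)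
    {a b : Dim} (e : Expr a b) :
    PowRel (G.adjMatrix ℂ) (H.adjMatrix ℂ) a b (e.eval (G.adjMatrix ℂ)) (e.eval (H.adjMatrix ℂ)) ∨
      RankOneRel P Q a b (e.eval (G.adjMatrix ℂ)) (e.eval (H.adjMatrix ℂ)) := by
  induction e with
  | X => exact Or.inl ⟨1, (pow_one _).symm, (pow_one _).symm⟩
  | @mul a b c e₁ e₂ ih₁ ih₂ =>
    simp only [Expr.eval]
    rcases ih₁ with h₁ | h₁ <;> rcases ih₂ with h₂ | h₂
    · rcases a with _ | _ <;> rcases b with _ | _ <;> rcases c with _ | _ <;>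
        first | exact h₁.elim | exact h₂.elim | skip
      obtain ⟨k, hk, hk'⟩ := h₁
      obtain ⟨m, hm, hm'⟩ := h₂
      exact Or.inl ⟨k + m, by rw [hk, hm, pow_add], by rw [hk', hm', pow_add]⟩
    · rcases a with _ | _ <;> rcases b with _ | _ <;> try exact h₁.elim
      obtain ⟨k, hk, hk'⟩ := h₁
      rw [hk, hk']
      exact Or.inr (h₂.pow_mul hP hQ hdeg k)
    · rcases b with _ | _ <;> rcases c with _ | _ <;> try exact h₂.elim
      obtain ⟨k, hk, hk'⟩ := h₂
      rw [hk, hk']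
      exact Or.inr (h₁.mul_pow hP hQ hdeg k)
    · exact Or.inr (h₁.mul hP.1 hQ.1 hcard h₂)
  | @tr a e ih =>
    have ht : (e.eval (G.adjMatrix ℂ)).trace = (e.eval (H.adjMatrix ℂ)).trace := by
      rcases ih with h | ⟨u, u', v, v', hu, hv, hM, hN⟩
      · rcases a with _ | _
        · exact h.elim
        · obtain ⟨k, hk, hk'⟩ := h
          rw [hk, hk']
          exact htr k
      · rw [hM, hN, trace_vecMulVec, trace_vecMulVec]
        exact (hu.mul hv).sum_eq hP.1 hQ.1 hcard
    refine Or.inr ⟨_, _, _, _, VecRel.const (e.eval (G.adjMatrix ℂ)).trace, VecRel.const 1, ?_, ?_⟩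
    · ext; simp [Expr.eval, vecMulVec_apply]
    · ext; simp [Expr.eval, vecMulVec_apply, ht]
  | @ctr a b e ih =>
    simp only [Expr.eval]
    rcases ih with h | h
    · rcases a with _ | _ <;> rcases b with _ | _ <;> try exact h.elim
      obtain ⟨k, hk, hk'⟩ := h
      rw [hk, hk']
      exact Or.inl ⟨k, conjTranspose_adjMatrix_pow G k, conjTranspose_adjMatrix_pow H k⟩
    · exact Or.inr h.conjTranspose
  | ones e ih =>
    refine Or.inr ⟨_, _, _, _, VecRel.const 1, VecRel.const 1, ?_, ?_⟩ <;>
      ext <;> simp [Expr.eval, vecMulVec_apply]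
  | @vmul a e₁ e₂ ih₁ ih₂ =>
    have h₁ := ih₁.resolve_left (by cases a <;> exact id)
    have h₂ := ih₂.resolve_left (by cases a <;> exact id)
    obtain ⟨u, u', v, v', hu, hv, hM, hN⟩ := h₁
    obtain ⟨x, x', y, y', hx, hy, hM', hN'⟩ := h₂
    refine Or.inr ⟨_, _, _, _, hu.mul hx, hv.mul hy, ?_, ?_⟩
    · ext
      simp only [Expr.eval, hM, hM', vecMulVec_apply, of_apply, Pi.mul_apply]
      ring
    · ext
      simp only [Expr.eval, hN, hN', vecMulVec_apply, of_apply, Pi.mul_apply]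
      ring

theorem graphEquiv_of_trace_pow_of_haveCommonEquitablePartition
    (htr : ∀ k : ℕ, (G.adjMatrix ℂ ^ k).trace = (H.adjMatrix ℂ ^ k).trace)
    (h : HaveCommonEquitablePartition G H) : GraphEquiv G H := by
  obtain ⟨l, P, Q, hP, hQ, hcard, hdeg⟩ := h
  intro e
  rcases powRel_or_rankOneRel_eval hP hQ hcard hdeg htr e with h | ⟨u, u', v, v', hu, hv, hM, hN⟩
  · exact h.elim
  · obtain rfl : u = u' := hu
    obtain rfl : v = v' := hv
    rw [hM, hN]

end Invariance

/-! ### The partition by the values of all vector expressions -/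

section Colours

variable {n : ℕ} {G H : SimpleGraph (Fin n)} [DecidableRel G.Adj] [DecidableRel H.Adj]

/-- The values of a vector expression on two matrices, as one function. -/
noncomputable def jointEval (A B : Matrix (Fin n) (Fin n) ℂ) (e : Expr Dim.ord Dim.one) :
    Fin n ⊕ Fin n → ℂ :=
  Sum.elim (fun v => e.eval A v 0) fun w => e.eval B w 0

/-- The range is already a multiplicative monoid, by `ones` and `vmul`, so adjoining only adds
linear combinations. -/
theorem adjoin_range_jointEval (A B : Matrix (Fin n) (Fin n) ℂ) :
    Subalgebra.toSubmodule (Algebra.adjoin ℂ (Set.range (jointEval A B))) =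
      Submodule.span ℂ (Set.range (jointEval A B)) := by
  let S : Submonoid (Fin n ⊕ Fin n → ℂ) :=
    { carrier := Set.range (jointEval A B)
      one_mem' := ⟨Expr.ones Expr.X, by ext (v | v) <;> rfl⟩
      mul_mem' := by
        rintro _ _ ⟨e, rfl⟩ ⟨f, rfl⟩
        exact ⟨Expr.vmul e f, by ext (v | v) <;> rfl⟩ }
  rw [Algebra.adjoin_eq_span]
  exact congrArg _ (congrArg _ S.closure_eq)

/-- The difference of the sums of the two components of a function. -/
def sumDiff (n : ℕ) : (Fin n ⊕ Fin n → ℂ) →ₗ[ℂ] ℂ :=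
  ∑ v, LinearMap.proj (Sum.inl v) - ∑ w, LinearMap.proj (Sum.inr w)

/-- Two matrices acting on the two components of a function. -/
def jointMulVec (A B : Matrix (Fin n) (Fin n) ℂ) :
    (Fin n ⊕ Fin n → ℂ) →ₗ[ℂ] (Fin n ⊕ Fin n → ℂ) where
  toFun f := Sum.elim (A *ᵥ (f ∘ Sum.inl)) (B *ᵥ (f ∘ Sum.inr))
  map_add' f g := by
    ext (v | v)
    · exact congrFun (mulVec_add A (f ∘ Sum.inl) (g ∘ Sum.inl)) v
    · exact congrFun (mulVec_add B (f ∘ Sum.inr) (g ∘ Sum.inr)) v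
  map_smul' z f := by
    ext (v | v)
    · exact congrFun (mulVec_smul A z (f ∘ Sum.inl)) v
    · exact congrFun (mulVec_smul B z (f ∘ Sum.inr)) v

variable {A B : Matrix (Fin n) (Fin n) ℂ}

theorem sumDiff_eq_zero (h : MatrixEquiv A B) {f : Fin n ⊕ Fin n → ℂ}
    (hf : f ∈ Submodule.span ℂ (Set.range (jointEval A B))) : sumDiff n f = 0 := by
  refine (Submodule.span_le (p := LinearMap.ker (sumDiff n))).2 ?_ hf
  rintro _ ⟨e, rfl⟩
  -- The sentence `𝟙(X)* · e` sums the entries of `e`.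
  have := congrFun₂ (h (Expr.mul (Expr.ctr (Expr.ones Expr.X)) e)) 0 0
  simpa [Expr.eval, mul_apply, sumDiff, jointEval, sub_eq_zero] using this

theorem jointMulVec_mem_span {f : Fin n ⊕ Fin n → ℂ}
    (hf : f ∈ Submodule.span ℂ (Set.range (jointEval A B))) :
    jointMulVec A B f ∈ Submodule.span ℂ (Set.range (jointEval A B)) := by
  refine (Submodule.span_le
    (p := (Submodule.span ℂ (Set.range (jointEval A B))).comap (jointMulVec A B))).2 ?_ hf
  rintro _ ⟨e, rfl⟩
  refine Submodule.subset_span ⟨Expr.mul Expr.X e, ?_⟩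
  ext (v | v) <;> rfl

/-- Two vertices have the same colour if no vector expression distinguishes them. -/
def colourSetoid (A B : Matrix (Fin n) (Fin n) ℂ) : Setoid (Fin n ⊕ Fin n) where
  r x y := ∀ e, jointEval A B e x = jointEval A B e y
  iseqv := ⟨fun _ _ => rfl, fun h e => (h e).symm, fun h₁ h₂ e => (h₁ e).trans (h₂ e)⟩

theorem apply_eq_of_mem_span {f : Fin n ⊕ Fin n → ℂ}
    (hf : f ∈ Submodule.span ℂ (Set.range (jointEval A B))) {x y : Fin n ⊕ Fin n}
    (hxy : colourSetoid A B x y) : f x = f y := by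
  induction hf using Submodule.span_induction with
  | mem f hf =>
    obtain ⟨e, rfl⟩ := hf
    exact hxy e
  | zero => rfl
  | add f g _ _ hf hg => rw [Pi.add_apply, Pi.add_apply, hf, hg]
  | smul z f _ hf => rw [Pi.smul_apply, Pi.smul_apply, hf]

open Classical in
theorem colour_indicator_mem_span (q : Quotient (colourSetoid A B)) :
    (fun x => if Quotient.mk _ x = q then (1 : ℂ) else 0) ∈
      Submodule.span ℂ (Set.range (jointEval A B)) := by
  induction q using Quotient.inductionOn with | _ y => ?_
  rw [← adjoin_range_jointEval, Subalgebra.mem_toSubmodule]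
  convert indicator_mem_adjoin (Set.range (jointEval A B)) y using 3 with x
  rw [Quotient.eq, Set.forall_mem_range]
  rfl

open Classical in
theorem card_colour_eq (h : MatrixEquiv A B) (q : Quotient (colourSetoid A B)) :
    #{v | Quotient.mk (colourSetoid A B) (Sum.inl v) = q} =
      #{w | Quotient.mk (colourSetoid A B) (Sum.inr w) = q} := by
  simpa [sumDiff, sub_eq_zero] using sumDiff_eq_zero h (colour_indicator_mem_span q)

open Classical in
theorem jointMulVec_colour_indicator
    (q : Quotient (colourSetoid (G.adjMatrix ℂ) (H.adjMatrix ℂ))) :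
    jointMulVec (G.adjMatrix ℂ) (H.adjMatrix ℂ)
        (fun x => if Quotient.mk _ x = q then (1 : ℂ) else 0) =
      Sum.elim (fun v => (degIn G v {x | Quotient.mk _ (Sum.inl x) = q} : ℂ))
        fun w => (degIn H w {x | Quotient.mk _ (Sum.inr x) = q} : ℂ) := by
  ext (v | v) <;>
    simp [jointMulVec, mulVec, dotProduct, SimpleGraph.adjMatrix_apply, degIn, filter_filter,
      ← ite_and]

theorem haveCommonEquitablePartition_of_graphEquiv (h : GraphEquiv G H) :
    HaveCommonEquitablePartition G H := by
  classical
  let s := colourSetoid (G.adjMatrix ℂ) (H.adjMatrix ℂ)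
  let φ : Quotient s ≃ Fin (Fintype.card (Quotient s)) := Fintype.equivFin _
  -- Here `x` and `y` may lie in the same graph or in different ones, which covers all three degree
  -- conditions at the end.
  have hdeg {q : Quotient s} {x y : Fin n ⊕ Fin n} (hxy : Quotient.mk s x = Quotient.mk s y) :=
    apply_eq_of_mem_span (jointMulVec_mem_span (colour_indicator_mem_span q)) (Quotient.exact hxy)
  simp only [jointMulVec_colour_indicator] at hdeg
  have hne (q : Quotient s) : (∃ v, Quotient.mk s (Sum.inl v) = q) ∧
      ∃ w, Quotient.mk s (Sum.inr w) = q := by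
    -- A colour class has as many vertices in `G` as in `H`, so a colour present in one graph is
    -- present in the other and all parts are nonempty.
    have hpos : 0 < #{v | Quotient.mk s (Sum.inl v) = q} ↔
        0 < #{w | Quotient.mk s (Sum.inr w) = q} := by rw [card_colour_eq h q]
    simp only [card_pos, filter_nonempty_iff, mem_univ, true_and] at hpos
    obtain ⟨v | w, hx⟩ := Quotient.exists_rep q
    · exact ⟨⟨v, hx⟩, hpos.1 ⟨v, hx⟩⟩
    · exact ⟨hpos.2 ⟨w, hx⟩, ⟨w, hx⟩⟩
  have hpart (f : Fin n → Fin n ⊕ Fin n) (hf : ∀ q, ∃ v, Quotient.mk s (f v) = q) :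
      IsPartition fun i => ({v | Quotient.mk s (f v) = φ.symm i} : Finset (Fin n)) := by
    refine ⟨fun i => ?_, fun v => ⟨φ (Quotient.mk s (f v)), by simp, fun j hj => ?_⟩⟩
    · simpa [filter_nonempty_iff] using hf (φ.symm i)
    · rw [(mem_filter.1 hj).2, Equiv.apply_symm_apply]
  refine ⟨_, fun i => {v | Quotient.mk s (Sum.inl v) = φ.symm i},
    fun i => {w | Quotient.mk s (Sum.inr w) = φ.symm i},
    ⟨hpart _ fun q => (hne q).1, fun i j v hv w hw => ?_⟩,
    ⟨hpart _ fun q => (hne q).2, fun i j v hv w hw => ?_⟩, fun i => card_colour_eq h _,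
    fun i j v hv w hw => ?_⟩ <;>
  · rw [mem_filter] at hv hw
    exact Nat.cast_injective (R := ℂ) (hdeg (hv.2.trans hw.2.symm))

end Colours

theorem trace_pow_eq_of_matrixEquiv {n : ℕ} {A B : Matrix (Fin n) (Fin n) ℂ}
    (h : MatrixEquiv A B) (k : ℕ) : (A ^ k).trace = (B ^ k).trace := by
  -- Exponents start at `1`, the product of copies of `X` being nonempty; for exponent `0` both
  -- traces are that of the identity.
  have hpow (k : ℕ) : ∃ e : Expr Dim.ord Dim.ord,
      ∀ C : Matrix (Fin n) (Fin n) ℂ, e.eval C = C ^ (k + 1) := by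
    induction k with
    | zero => exact ⟨Expr.X, fun C => (pow_one C).symm.trans (by rw [zero_add])⟩
    | succ k ih =>
      obtain ⟨e, he⟩ := ih
      exact ⟨Expr.mul e Expr.X, fun C => by rw [pow_succ, ← he]; rfl⟩
  cases k with
  | zero => rw [pow_zero, pow_zero]
  | succ k =>
    obtain ⟨e, he⟩ := hpow k
    rw [← he, ← he]
    exact congrFun₂ (h (Expr.tr e)) 0 0

end MatLang

theorem mainTheorem4 {n : ℕ} (G H : SimpleGraph (Fin n)) [DecidableRel G.Adj]
    [DecidableRel H.Adj] :
    MatLang.GraphEquiv G H ↔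
      MatLang.CoSpectral G H ∧ MatLang.HaveCommonEquitablePartition G H := by
  rw [MatLang.coSpectral_iff_trace_pow]
  exact ⟨fun h => ⟨MatLang.trace_pow_eq_of_matrixEquiv h,
    MatLang.haveCommonEquitablePartition_of_graphEquiv h⟩,
    fun h => MatLang.graphEquiv_of_trace_pow_of_haveCommonEquitablePartition h.1 h.2⟩
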